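/- Let $A$ be a finite set and $(A,\mathrm{cl})$ a pregeometry (a closure operation on the subsets of $A$ with the exchange property), with dimension function $d$. A subset $F\subseteq A$ is closed if $\mathrm{cl}(F)=F$. For $X\subseteq A$ let $\mathcal F(X)$ be the set of closed sets $F$ with $F\subsetneq X$. Define $\alpha$ on unions of closed sets recursively by $$\alpha(X)=|X|-d(X)-\sum_{G\in\mathcal F(X)}\alpha(G).$$ For a set $\mathcal F$ of closed sets and $\emptyset\ne S\subseteq\mathcal F$ put $F_S=\bigcap S$, put $F_\emptyset=\bigcup\mathcal F$, and let $$\Delta(\mathcal F)=\sum_{S\subseteq\mathcal F}(-1)^{|S|}d(F_S)$$ (so $\Delta(\emptyset)=d(\emptyset)=0$). The pregeometry is flat (in the sense of Hrushovski) if $\Delta(\mathcal F)\le 0$ for every nonempty set $\mathcal F$ of closed sets. For a set $R$ of nonempty subsets of $A$ let $\delta(X)=|X|-|\{r\in R: r\subseteq X\}|$ for $X\subseteq A$, and write $(A;R)\in\mathcal C$ if $\delta(X)\ge 0$ for all $X\subseteq A$. In that case let $d_R(X)=\min\{\delta(Y): X\subseteq Y\subseteq A\}$, and let $PG(A;R)$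 be the pregeometry on $A$ with closure operation $X\mapsto\{y\in A: d_R(X\cup\{y\})=d_R(X)\}$. The following are equivalent: 1. There is a set $R$ of nonempty subsets of $A$ such that $(A;R)\in\mathcal C$ and $PG(A;R)=(A,\mathrm{cl})$. 2. $\alpha(X)\ge 0$ for every $X\subseteq A$ which is a union of closed sets. 3. $\Delta(\mathcal F(X))\le 0$ for every $X\subseteq A$ which is a union of closed sets. 4. $(A,\mathrm{cl})$ is flat. Moreover, suppose that these conditions hold. Then for every integer $k\ge 2$, the set $R$ in (1) can be taken to consist of sets of size at most $k$ if and only if $\Delta(\mathcal F(X))=0$ for every closed set $X$ of dimension at least $k$. The "only if" direction holds for every integer $k\ge 0$. -/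

import Mathlib

/-- A finite pregeometry `(A, cl)`: a closure operator on the power set `Finset A` of the finite
set `A` which satisfies the exchange property. (Since `A` is finite, `Finset A` is the full power
set, and every closure operator is automatically finitary.) -/
structure FinPregeometry (A : Type*) [Fintype A] [DecidableEq A] where
  /-- The closure operator. -/
  cl : ClosureOperator (Finset A)
  /-- The exchange property. -/
  exchange : ∀ (X : Finset A) (a b : A), a ∈ cl (insert b X) → a ∉ cl X → b ∈ cl (insert a X)

namespace FinPregeometry

variable {A : Type*} [Fintype A] [DecidableEq A] (P : FinPregeometry A)

/-- The dimension `d(X)`: the least cardinality of a subset `Y` of `X` with `X ⊆ cl Y`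
(that is, the common cardinality of the bases of `X`). -/
def dim (X : Finset A) : ℕ :=
  (X.powerset.filter (fun Y => X ⊆ P.cl Y)).inf'
    ⟨X, Finset.mem_filter.2 ⟨Finset.mem_powerset_self X, P.cl.le_closure X⟩⟩ Finset.card

/-- `F` is a closed set. -/
def IsFlat (F : Finset A) : Prop := P.cl F = F

instance (F : Finset A) : Decidable (P.IsFlat F) := inferInstanceAs (Decidable (P.cl F = F))

/-- `X` is a union of closed sets. -/
def IsUnionOfFlats (X : Finset A) : Prop :=
  ∃ 𝓖 : Finset (Finset A), (∀ F ∈ 𝓖, P.IsFlat F) ∧ X = 𝓖.biUnion id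

/-- `𝓕(X)`: the set of closed sets properly contained in `X`. -/
def properFlats (X : Finset A) : Finset (Finset A) := X.ssubsets.filter P.IsFlat

theorem card_lt_of_mem_properFlats {X G : Finset A} (h : G ∈ P.properFlats X) :
    G.card < X.card :=
  Finset.card_lt_card (Finset.mem_ssubsets.1 (Finset.mem_filter.1 h).1)

/-- The `α`-function, `α(X) = |X| - d(X) - ∑_{G closed, G ⊂ X} α(G)`. It is of interest for unions
of closed sets `X`; the same recursion makes sense for every `X`. -/
def alpha (X : Finset A) : ℤ :=
  (X.card : ℤ) - (P.dim X : ℤ) - ∑ G : {G : Finset A // G ∈ P.properFlats X}, alpha G.1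
termination_by X.card
decreasing_by exact P.card_lt_of_mem_properFlats G.2

/-- The defining recursion of `α`, as a sum over `𝓕(X)`. -/
theorem alpha_eq (X : Finset A) :
    P.alpha X = (X.card : ℤ) - (P.dim X : ℤ) - ∑ G ∈ P.properFlats X, P.alpha G := by
  rw [alpha, Finset.sum_coe_sort (P.properFlats X) P.alpha]

/-- For a set `S` of members of `𝓕`: the intersection `F_S` of the members of `S` if `S` is
nonempty, and the union of all members of `𝓕` if `S` is empty. -/
def interOrUnion (𝓕 S : Finset (Finset A)) : Finset A :=
  if S = ∅ then 𝓕.biUnion id else S.inf id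

/-- `Δ(𝓕) = ∑_{S ⊆ 𝓕} (-1)^|S| d(F_S)`. (For `𝓕 = ∅` this is `d(∅) = 0`.) -/
def Delta (𝓕 : Finset (Finset A)) : ℤ :=
  ∑ S ∈ 𝓕.powerset, (-1) ^ S.card * (P.dim (interOrUnion 𝓕 S) : ℤ)

/-- Flatness: `Δ(𝓕) ≤ 0` for every nonempty finite set `𝓕` of closed sets. -/
def IsFlatPregeometry : Prop :=
  ∀ 𝓕 : Finset (Finset A), 𝓕.Nonempty → (∀ F ∈ 𝓕, P.IsFlat F) → P.Delta 𝓕 ≤ 0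

end FinPregeometry

namespace SetSystem

variable {A : Type*} [Fintype A] [DecidableEq A] (R : Finset (Finset A))

/-- The predimension `δ(X) = |X| - |R[X]|` of the set system `(A; R)`, where
`R[X] = {r ∈ R : r ⊆ X}`. -/
def delta (X : Finset A) : ℤ :=
  (X.card : ℤ) - ((R.filter (fun r => r ⊆ X)).card : ℤ)

/-- `(A; R)` belongs to the class `𝒞`: the members of `R` are nonempty, and `δ(X) ≥ 0` for
all `X ⊆ A`. -/
def MemC : Prop := (∀ r ∈ R, r.Nonempty) ∧ ∀ X : Finset A, 0 ≤ delta R X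

/-- The dimension `d(X) = min {δ(Y) : X ⊆ Y ⊆ A}` attached to `(A; R)`. -/
def dim (X : Finset A) : ℤ :=
  (Finset.univ.filter (fun Y : Finset A => X ⊆ Y)).inf'
    ⟨X, Finset.mem_filter.2 ⟨Finset.mem_univ X, Finset.Subset.refl X⟩⟩ (delta R)

/-- The closure operation `cl(X) = {y ∈ A : d(X ∪ {y}) = d(X)}` of `PG(A; R)`. -/
def closure (X : Finset A) : Finset A :=
  Finset.univ.filter (fun y => dim R (X ∪ {y}) = dim R X)

/-- `(A; R) ∈ 𝒞` and `PG(A; R) = (A, cl)`, i.e. the two closure operations on `A` coincide. -/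
def Presents (P : FinPregeometry A) : Prop :=
  MemC R ∧ ∀ X : Finset A, closure R X = P.cl X

end SetSystem

/-! ### Closure, independence and dimension in a finite pregeometry -/

namespace FinPregeometry

variable {A : Type*} [Fintype A] [DecidableEq A] (P : FinPregeometry A)

/-! Call `|X| - d(X)` the nullity of `X`. In a presentation `R`, the nullity of a flat is the number
of members of `R` below it, and for other sets this number is at most the nullity.
Inclusion-exclusion (`Delta_eq_of_weights`) then turns `Δ(𝓕)` into `d(U) - |U|` plus the number of
members below some `F ∈ 𝓕`, where `U = ⋃ 𝓕`. Such members lie below `U`, so `Δ(𝓕) ≤ 0`. The same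
formula with weights `α` gives `α(X) = -Δ(𝓕(X))` whenever `X` is the union of its proper subflats;
the exceptional flats have dimension at most one.

Conversely, if `α ≥ 0`, repeat each flat `F` exactly `α(F)` times. This family has the right counts,
but its members may coincide, hence the use of indexed families. A supermodularity argument
(`exists_shrink`) removes points from members without changing their closures or spoiling the
counts, until each member has nullity one; the members are then distinct. Each of them spans a flat
with `α > 0` and has one element more than the dimension of that flat, which yields the size bound.
-/

theorem cl_subset_iff {X Y : Finset A} : P.cl X ⊆ P.cl Y ↔ X ⊆ P.cl Y :=
  P.cl.isClosed_closure Y |>.closure_le_iff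

theorem subset_cl (X : Finset A) : X ⊆ P.cl X := P.cl.le_closure X

theorem cl_mono {X Y : Finset A} (h : X ⊆ Y) : P.cl X ⊆ P.cl Y := P.cl.monotone h

theorem cl_cl (X : Finset A) : P.cl (P.cl X) = P.cl X := P.cl.idempotent X

theorem isFlat_cl (X : Finset A) : P.IsFlat (P.cl X) := P.cl_cl X

variable {P} in
theorem IsFlat.cl_subset_iff {X F : Finset A} (hF : P.IsFlat F) : P.cl X ⊆ F ↔ X ⊆ F := by
  have h := P.cl_subset_iff (X := X) (Y := F)
  rwa [show P.cl F = F from hF] at h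

/-- `Z` is independent: no element lies in the closure of the others. -/
def Indep (Z : Finset A) : Prop := ∀ z ∈ Z, z ∉ P.cl (Z.erase z)

variable {P} in
theorem Indep.erase {Z : Finset A} (hZ : P.Indep Z) (z : A) : P.Indep (Z.erase z) := by
  intro w hw h
  refine hZ w (Finset.mem_of_mem_erase hw) (P.cl_mono ?_ h)
  exact Finset.erase_subset_erase _ (Finset.erase_subset _ _)

variable {P} in
theorem Indep.insert_of_notMem_cl {Z : Finset A} (hZ : P.Indep Z) {y : A} (hy : y ∉ P.cl Z) :
    P.Indep (insert y Z) := by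
  have hyZ : y ∉ Z := fun h => hy (P.subset_cl Z h)
  intro w hw h
  rcases Finset.mem_insert.1 hw with rfl | hwZ
  · rw [Finset.erase_insert hyZ] at h
    exact hy h
  · have hne : y ≠ w := fun e => hyZ (e ▸ hwZ)
    rw [Finset.erase_insert_of_ne hne] at h
    have := P.exchange _ _ _ h (hZ w hwZ)
    rw [Finset.insert_erase hwZ] at this
    exact hy this

variable {P} in
-- Steinitz exchange: trade an element of `Z \ Y` for one of `Y` outside the closure of the rest of
-- `Z`, by induction on `|Z \ Y|`.
theorem Indep.card_le {Y : Finset A} : ∀ {Z : Finset A}, P.Indep Z → Z ⊆ P.cl Y →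
    Z.card ≤ Y.card := by
  suffices H : ∀ (n : ℕ) (Z : Finset A), (Z \ Y).card = n → P.Indep Z → Z ⊆ P.cl Y →
      Z.card ≤ Y.card from fun {Z} => H _ Z rfl
  intro n
  induction n with
  | zero =>
    intro Z hn _ _
    exact Finset.card_le_card (Finset.sdiff_eq_empty_iff_subset.1 (Finset.card_eq_zero.1 hn))
  | succ n ih =>
    intro Z hn hZ hZY
    obtain ⟨z, hz⟩ : (Z \ Y).Nonempty := Finset.card_pos.1 (by omega)
    obtain ⟨hzZ, hzY⟩ := Finset.mem_sdiff.1 hz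
    obtain ⟨y, hyY, hy⟩ : ∃ y ∈ Y, y ∉ P.cl (Z.erase z) := by
      by_contra! h
      exact hZ z hzZ (P.cl_subset_iff.2 h (hZY hzZ))
    have hyZ : y ∉ Z.erase z := fun h => hy (P.subset_cl _ h)
    have hcard : (insert y (Z.erase z)).card = Z.card := by
      rw [Finset.card_insert_of_notMem hyZ, Finset.card_erase_add_one hzZ]
    rw [← hcard]
    refine ih _ ?_ ((hZ.erase z).insert_of_notMem_cl hy) ?_
    · have : insert y (Z.erase z) \ Y = (Z \ Y).erase z := by
        rw [Finset.insert_sdiff_of_mem _ hyY, Finset.erase_sdiff_comm]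
      rw [this, Finset.card_erase_of_mem hz, hn]
      rfl
    · exact Finset.insert_subset (P.subset_cl Y hyY) ((Finset.erase_subset _ _).trans hZY)

theorem dim_le_card {X Y : Finset A} (hYX : Y ⊆ X) (hXY : X ⊆ P.cl Y) : P.dim X ≤ Y.card :=
  Finset.inf'_le _ (Finset.mem_filter.2 ⟨Finset.mem_powerset.2 hYX, hXY⟩)

theorem dim_le_card_self (X : Finset A) : P.dim X ≤ X.card :=
  P.dim_le_card subset_rfl (P.subset_cl X)

/-- Every set has a basis. -/
theorem exists_basis (X : Finset A) :
    ∃ B ⊆ X, X ⊆ P.cl B ∧ P.Indep B ∧ B.card = P.dim X := by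
  obtain ⟨B, hB, hcard⟩ := Finset.exists_mem_eq_inf'
    (s := X.powerset.filter (fun Y => X ⊆ P.cl Y))
    ⟨X, Finset.mem_filter.2 ⟨Finset.mem_powerset_self X, P.cl.le_closure X⟩⟩ Finset.card
  obtain ⟨hBX, hXB⟩ := Finset.mem_filter.1 hB
  rw [Finset.mem_powerset] at hBX
  have hdim : B.card = P.dim X := hcard.symm
  refine ⟨B, hBX, hXB, fun b hb hcl => ?_, hdim⟩
  have hB' : B ⊆ P.cl (B.erase b) := by
    intro c hc
    by_cases h : c = b
    · rwa [h]
    · exact P.subset_cl _ (Finset.mem_erase.2 ⟨h, hc⟩)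
  have := P.dim_le_card ((Finset.erase_subset b B).trans hBX)
    (hXB.trans (P.cl_subset_iff.2 hB'))
  have := Finset.card_erase_lt_of_mem hb
  omega

theorem dim_le_dim {X Y : Finset A} (h : X ⊆ P.cl Y) : P.dim X ≤ P.dim Y := by
  obtain ⟨B, hBX, -, hB, hBc⟩ := P.exists_basis X
  obtain ⟨C, -, hYC, -, hCc⟩ := P.exists_basis Y
  rw [← hBc, ← hCc]
  exact hB.card_le ((hBX.trans h).trans (P.cl_subset_iff.2 hYC))

theorem dim_mono {X Y : Finset A} (h : X ⊆ Y) : P.dim X ≤ P.dim Y :=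
  P.dim_le_dim (h.trans (P.subset_cl Y))

theorem dim_eq_of_subset_cl {X Y : Finset A} (h : X ⊆ Y) (h' : Y ⊆ P.cl X) :
    P.dim Y = P.dim X :=
  (P.dim_le_dim h').antisymm (P.dim_mono h)

theorem dim_cl (X : Finset A) : P.dim (P.cl X) = P.dim X :=
  P.dim_eq_of_subset_cl (P.subset_cl X) subset_rfl

theorem dim_empty : P.dim ∅ = 0 := Nat.le_zero.1 (P.dim_le_card_self ∅)

theorem dim_insert_of_mem {X : Finset A} {y : A} (h : y ∈ P.cl X) :
    P.dim (insert y X) = P.dim X :=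
  P.dim_eq_of_subset_cl (Finset.subset_insert y X) (Finset.insert_subset h (P.subset_cl X))

theorem dim_insert_of_notMem {X : Finset A} {y : A} (h : y ∉ P.cl X) :
    P.dim (insert y X) = P.dim X + 1 := by
  obtain ⟨B, hBX, hXB, hB, hBc⟩ := P.exists_basis X
  have hyB : y ∉ P.cl B := fun hy => h (P.cl_mono hBX hy)
  have hcard : (insert y B).card = P.dim X + 1 := by
    rw [Finset.card_insert_of_notMem fun hy => hyB (P.subset_cl B hy), hBc]
  refine le_antisymm ?_ ?_
  · rw [← hcard]
    refine P.dim_le_card (Finset.insert_subset_insert y hBX) (Finset.insert_subset ?_ ?_)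
    · exact P.subset_cl _ (Finset.mem_insert_self y B)
    · exact hXB.trans (P.cl_mono (Finset.subset_insert y B))
  · obtain ⟨C, -, hYC, -, hCc⟩ := P.exists_basis (insert y X)
    rw [← hcard, ← hCc]
    exact (hB.insert_of_notMem_cl hyB).card_le ((Finset.insert_subset_insert y hBX).trans hYC)

theorem dim_insert_eq_iff {X : Finset A} {y : A} :
    P.dim (insert y X) = P.dim X ↔ y ∈ P.cl X := by
  refine ⟨fun h => ?_, P.dim_insert_of_mem⟩
  by_contra hy
  have := P.dim_insert_of_notMem hy
  omega

theorem dim_le_add_card_sdiff {U X : Finset A} (h : U ⊆ X) :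
    P.dim X ≤ P.dim U + (X \ U).card := by
  obtain ⟨B, hBU, hUB, -, hBc⟩ := P.exists_basis U
  rw [← hBc]
  refine (P.dim_le_card (Finset.union_subset (hBU.trans h) Finset.sdiff_subset) ?_).trans
    (Finset.card_union_le B (X \ U))
  rw [← Finset.union_sdiff_of_subset h]
  refine Finset.union_subset (hUB.trans (P.cl_mono Finset.subset_union_left)) ?_
  rw [Finset.union_sdiff_of_subset h]
  exact Finset.subset_union_right.trans (P.subset_cl _)

/-! ### Inclusion-exclusion for `Δ` -/

theorem isFlat_inf' {𝓢 : Finset (Finset A)} (hne : 𝓢.Nonempty) (h : ∀ F ∈ 𝓢, P.IsFlat F) :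
    P.IsFlat (𝓢.inf' hne id) := by
  refine Finset.Subset.antisymm ?_ (P.subset_cl _)
  refine Finset.le_inf' hne _ fun F hF => ?_
  exact (h F hF).cl_subset_iff.2 (Finset.inf'_le (f := id) hF)

theorem mem_properFlats {X G : Finset A} : G ∈ P.properFlats X ↔ G ⊂ X ∧ P.IsFlat G := by
  simp [properFlats]

theorem interOrUnion_of_nonempty (𝓕 : Finset (Finset A)) {S : Finset (Finset A)}
    (hS : S.Nonempty) : interOrUnion 𝓕 S = S.inf' hS id := by
  rw [interOrUnion, if_neg hS.ne_empty, Finset.inf'_eq_inf]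

theorem Delta_eq_add_sum_nonempty (𝓕 : Finset (Finset A)) :
    P.Delta 𝓕 = P.dim (𝓕.biUnion id) +
      ∑ S ∈ 𝓕.powerset with S.Nonempty, (-1) ^ S.card * (P.dim (interOrUnion 𝓕 S) : ℤ) := by
  have hsplit : 𝓕.powerset.filter (·.Nonempty) = 𝓕.powerset.erase ∅ := by
    ext S
    simp only [Finset.mem_filter, Finset.mem_erase, Finset.nonempty_iff_ne_empty, and_comm]
  rw [Delta, hsplit, ← Finset.add_sum_erase _ _ (Finset.empty_mem_powerset 𝓕)]
  simp [interOrUnion]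

theorem inf'_filter_subset (𝓖 : Finset (Finset A)) {S : Finset (Finset A)} (hS : S.Nonempty) :
    S.inf' hS (fun F => 𝓖.filter (· ⊆ F)) = 𝓖.filter (· ⊆ S.inf' hS id) := by
  ext H
  have hmem : H ∈ S.inf' hS (fun F => 𝓖.filter (· ⊆ F)) ↔ ∀ F ∈ S, H ∈ 𝓖.filter (· ⊆ F) := by
    rw [← Finset.singleton_subset_iff]
    simp only [← Finset.singleton_subset_iff (a := H)]
    exact Finset.le_inf'_iff _ _
  have hle : H ⊆ S.inf' hS id ↔ ∀ F ∈ S, H ⊆ F := Finset.le_inf'_iff hS id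
  rw [hmem, Finset.mem_filter, hle]
  simp only [Finset.mem_filter]
  exact ⟨fun h => ⟨(h _ hS.choose_spec).1, fun F hF => (h F hF).2⟩,
    fun h F hF => ⟨h.1, h.2 F hF⟩⟩

/-- Inclusion-exclusion for the sum of weights over the members of `𝓖` below a member of `𝓕`. -/
theorem sum_below_eq (𝓖 𝓕 : Finset (Finset A)) (w : Finset A → ℤ) :
    ∑ H ∈ 𝓖 with ∃ F ∈ 𝓕, H ⊆ F, w H =
      ∑ S ∈ 𝓕.powerset with S.Nonempty, (-1) ^ (S.card + 1) *
        ∑ H ∈ 𝓖 with H ⊆ interOrUnion 𝓕 S, w H := by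
  have hU : 𝓕.biUnion (fun F => 𝓖.filter (· ⊆ F)) = 𝓖.filter (fun H => ∃ F ∈ 𝓕, H ⊆ F) := by
    ext H
    simp only [Finset.mem_biUnion, Finset.mem_filter]
    tauto
  rw [← hU, Finset.inclusion_exclusion_sum_biUnion,
    ← Finset.sum_coe_sort (𝓕.powerset.filter (·.Nonempty))]
  refine Finset.sum_congr rfl fun S _ => ?_
  rw [smul_eq_mul, inf'_filter_subset, interOrUnion_of_nonempty 𝓕 (Finset.mem_filter.1 S.2).2]

theorem card_biUnion_eq_sum_interOrUnion (𝓕 : Finset (Finset A)) :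
    ((𝓕.biUnion id).card : ℤ) =
      ∑ S ∈ 𝓕.powerset with S.Nonempty,
        (-1) ^ (S.card + 1) * ((interOrUnion 𝓕 S).card : ℤ) := by
  rw [Finset.inclusion_exclusion_card_biUnion, 
    ← Finset.sum_coe_sort (𝓕.powerset.filter (·.Nonempty))]
  refine Finset.sum_congr rfl fun S _ => ?_
  rw [interOrUnion_of_nonempty 𝓕 (Finset.mem_filter.1 S.2).2]

/-- If nullities of flats are sums of weights `w` of the members of `𝓖` below them, then `Δ(𝓕)` is
determined by the total weight of the members of `𝓖` which are below some member of `𝓕`. -/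
theorem Delta_eq_of_weights (𝓖 : Finset (Finset A)) (w : Finset A → ℤ)
    (hw : ∀ F, P.IsFlat F → (F.card : ℤ) - P.dim F = ∑ H ∈ 𝓖 with H ⊆ F, w H)
    (𝓕 : Finset (Finset A)) (h𝓕 : ∀ F ∈ 𝓕, P.IsFlat F) :
    P.Delta 𝓕 = P.dim (𝓕.biUnion id) - (𝓕.biUnion id).card
      + ∑ H ∈ 𝓖 with ∃ F ∈ 𝓕, H ⊆ F, w H := by
  rw [P.Delta_eq_add_sum_nonempty, card_biUnion_eq_sum_interOrUnion, sum_below_eq, sub_add,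
    ← Finset.sum_sub_distrib, sub_eq_add_neg, ← Finset.sum_neg_distrib]
  congr 1
  refine Finset.sum_congr rfl fun S hS => ?_
  obtain ⟨hS, hne⟩ := Finset.mem_filter.1 hS
  -- The weight formula applies to `F_S` because an intersection of flats is a flat.
  rw [← hw, pow_succ]
  · ring
  · rw [interOrUnion_of_nonempty 𝓕 hne]
    exact P.isFlat_inf' hne fun F hF => h𝓕 F (Finset.mem_powerset.1 hS hF)

end FinPregeometry

/-! ### The relation between `α` and `Δ` -/

namespace FinPregeometry

variable {A : Type*} [Fintype A] [DecidableEq A] (P : FinPregeometry A)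

variable {P} in
-- On flats, `α` is the Möbius inverse of nullity: this is its recursion with `α(F)` moved into the
-- sum.
theorem IsFlat.sum_alpha_eq {F : Finset A} (hF : P.IsFlat F) :
    (F.card : ℤ) - P.dim F = ∑ H ∈ Finset.univ.filter P.IsFlat with H ⊆ F, P.alpha H := by
  have h : (Finset.univ.filter P.IsFlat).filter (· ⊆ F) = insert F (P.properFlats F) := by
    ext H
    simp only [Finset.mem_filter, Finset.mem_univ, true_and, Finset.mem_insert, mem_properFlats]
    constructor
    · rintro ⟨h1, h2⟩
      rcases h2.eq_or_ssubset with h | h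
      · exact Or.inl h
      · exact Or.inr ⟨h, h1⟩
    · rintro (rfl | h)
      · exact ⟨hF, subset_rfl⟩
      · exact ⟨h.2, h.1.subset⟩
  rw [h, Finset.sum_insert fun h => (P.mem_properFlats.1 h).1.ne rfl, P.alpha_eq F]
  ring

theorem biUnion_properFlats_subset (X : Finset A) : (P.properFlats X).biUnion id ⊆ X :=
  Finset.biUnion_subset.2 fun _ hG => (P.mem_properFlats.1 hG).1.subset

/-- A flat below a member of `𝓕(X)` is itself in `𝓕(X)`, so the weighted sum runs over `𝓕(X)`. -/
theorem Delta_properFlats (X : Finset A) :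
    P.Delta (P.properFlats X) = P.dim ((P.properFlats X).biUnion id)
      - ((P.properFlats X).biUnion id).card + ∑ G ∈ P.properFlats X, P.alpha G := by
  rw [P.Delta_eq_of_weights (Finset.univ.filter P.IsFlat) P.alpha (fun F hF => hF.sum_alpha_eq) _
    fun F hF => (P.mem_properFlats.1 hF).2]
  congr 2
  ext H
  simp only [Finset.mem_filter, Finset.mem_univ, true_and, mem_properFlats]
  constructor
  · rintro ⟨h1, F, h2, h3⟩
    exact ⟨h3.trans_ssubset h2.1, h1⟩
  · exact fun h => ⟨h.2, H, h, subset_rfl⟩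

theorem alpha_eq_neg_Delta {X : Finset A} (h : (P.properFlats X).biUnion id = X) :
    P.alpha X = -P.Delta (P.properFlats X) := by
  rw [P.Delta_properFlats, P.alpha_eq, h]
  ring

theorem Delta_empty : P.Delta ∅ = 0 := by
  simp [Delta, interOrUnion, dim_empty]

variable {P} in
theorem IsUnionOfFlats.isFlat {X : Finset A} (hX : P.IsUnionOfFlats X)
    (h : (P.properFlats X).biUnion id ≠ X) : P.IsFlat X := by
  obtain ⟨𝓖, h𝓖, rfl⟩ := hX
  by_contra hX
  refine h (Finset.Subset.antisymm (P.biUnion_properFlats_subset _) ?_)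
  refine Finset.biUnion_subset.2 fun F hF => ?_
  refine Finset.subset_biUnion_of_mem id (P.mem_properFlats.2 ⟨?_, h𝓖 F hF⟩)
  refine (Finset.subset_biUnion_of_mem id hF).ssubset_of_ne fun e => hX ?_
  exact (show F = _ from e) ▸ h𝓖 F hF

/-- A flat which is not the union of its proper subflats has dimension at most one. -/
theorem of_biUnion_properFlats_ne {X : Finset A} (hX : P.IsFlat X)
    (h : (P.properFlats X).biUnion id ≠ X) :
    P.Delta (P.properFlats X) = 0 ∧ 0 ≤ P.alpha X ∧ P.dim X ≤ 1 := by
  obtain ⟨x, hxX, hx⟩ := Finset.exists_of_ssubset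
    ((P.biUnion_properFlats_subset X).ssubset_of_ne h)
  have hcl : P.cl {x} = X := by
    by_contra hne
    refine hx (Finset.mem_biUnion.2 ⟨P.cl {x}, P.mem_properFlats.2 ⟨?_, P.isFlat_cl _⟩,
      P.subset_cl _ (Finset.mem_singleton_self x)⟩)
    exact (hX.cl_subset_iff.2 (Finset.singleton_subset_iff.2 hxX)).ssubset_of_ne hne
  have hdim : P.dim X ≤ 1 := by
    rw [← hcl, dim_cl]
    exact P.dim_le_card_self {x}
  -- By exchange, a point of `G` outside `cl ∅` would have `x` in its closure, forcing `x ∈ G`.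
  have hempty : ∀ G ∈ P.properFlats X, G = P.cl ∅ := by
    intro G hG
    obtain ⟨hGX, hGf⟩ := P.mem_properFlats.1 hG
    refine Finset.Subset.antisymm (fun y hy => ?_)
      (hGf.cl_subset_iff.2 (Finset.empty_subset G))
    by_contra hy0
    have hyx : y ∈ P.cl (insert x ∅) := by
      rw [insert_empty_eq, hcl]
      exact hGX.subset hy
    have hxy := P.exchange ∅ y x hyx hy0
    rw [insert_empty_eq] at hxy
    exact hx (Finset.mem_biUnion.2 ⟨G, hG,
      hGf.cl_subset_iff.2 (Finset.singleton_subset_iff.2 hy) hxy⟩)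
  have hd0 : P.dim (P.cl ∅) = 0 := by rw [dim_cl, dim_empty]
  have hXc := P.dim_le_card_self X
  rcases (P.properFlats X).eq_empty_or_nonempty with h0 | ⟨G, hG⟩
  · rw [h0, Delta_empty, P.alpha_eq, h0, Finset.sum_empty]
    refine ⟨rfl, by omega, hdim⟩
  · have hs : P.properFlats X = {P.cl ∅} :=
      Finset.eq_singleton_iff_unique_mem.2 ⟨hempty G hG ▸ hG, hempty⟩
    have hp : P.properFlats (P.cl ∅) = ∅ := by
      refine Finset.eq_empty_of_forall_notMem fun H hH => ?_
      obtain ⟨h1, h2⟩ := P.mem_properFlats.1 hH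
      exact h1.not_subset (h2.cl_subset_iff.2 (Finset.empty_subset H))
    have hlt := P.card_lt_of_mem_properFlats (hempty G hG ▸ hG)
    have ha : P.alpha (P.cl ∅) = (P.cl ∅).card := by
      rw [P.alpha_eq, hp, hd0]
      simp
    refine ⟨?_, ?_, hdim⟩
    · rw [P.Delta_properFlats, hs, Finset.singleton_biUnion, Finset.sum_singleton, ha, id, hd0]
      simp
    · rw [P.alpha_eq, hs, Finset.sum_singleton, ha]
      omega

/-- If `α` is nonnegative on unions of flats, then the values of `α` on the flats contained in `X`
add up to at most the nullity of `X`. -/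
theorem sum_alpha_le (h : ∀ X, P.IsUnionOfFlats X → 0 ≤ P.alpha X) (X : Finset A) :
    ∑ H ∈ Finset.univ.filter P.IsFlat with H ⊆ X, P.alpha H ≤ (X.card : ℤ) - P.dim X := by
  set 𝓗 := (Finset.univ.filter P.IsFlat).filter (· ⊆ X) with h𝓗
  have hm : ∀ {H}, H ∈ 𝓗 ↔ P.IsFlat H ∧ H ⊆ X := by simp [h𝓗]
  set U := 𝓗.biUnion id with hU
  have hUX : U ⊆ X := Finset.biUnion_subset.2 fun H hH => (hm.1 hH).2
  have hUu : P.IsUnionOfFlats U := ⟨𝓗, fun F hF => (hm.1 hF).1, rfl⟩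
  have hle : ∀ {H}, H ∈ 𝓗 → H ⊆ U := fun hH => Finset.subset_biUnion_of_mem id hH
  have key : ∑ H ∈ 𝓗, P.alpha H ≤ (U.card : ℤ) - P.dim U := by
    by_cases hf : P.IsFlat U
    · rw [hf.sum_alpha_eq]
      refine (Finset.sum_congr ?_ fun _ _ => rfl).le
      ext H
      simp only [hm, Finset.mem_filter, Finset.mem_univ, true_and]
      exact ⟨fun hH => ⟨hH.1, hle (hm.2 hH)⟩, fun hH => ⟨hH.1, hH.2.trans hUX⟩⟩
    -- If `U` is not a flat, all flats below it are proper and the bound is exactly `α(U) ≥ 0`.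
    · have h0 := h U hUu
      have e : P.properFlats U = 𝓗 := by
        ext H
        rw [mem_properFlats]
        refine ⟨fun hH => hm.2 ⟨hH.2, hH.1.subset.trans hUX⟩, fun hH => ⟨?_, (hm.1 hH).1⟩⟩
        exact (hle hH).ssubset_of_ne fun e => hf (e ▸ (hm.1 hH).1)
      rw [P.alpha_eq, e] at h0
      omega
  have h1 := P.dim_le_add_card_sdiff hUX
  have h2 := Finset.card_sdiff_add_card_eq_card hUX
  omega

/-- The number of members of the family `r` contained in `X`. -/
def countBelow {ι : Type*} [Fintype ι] (r : ι → Finset A) (X : Finset A) : ℕ :=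
  (Finset.univ.filter fun i => r i ⊆ X).card

/-- Families of sets presenting `P`: the number of members below a set is at most its nullity, with
equality for flats. -/
structure IsPresentation {ι : Type*} [Fintype ι] (r : ι → Finset A) : Prop where
  le : ∀ X, countBelow r X + P.dim X ≤ X.card
  eq : ∀ F, P.IsFlat F → countBelow r F + P.dim F = F.card

/-! ### Supermodularity of the count -/

section countBelow

variable {ι : Type*} [Fintype ι] (r : ι → Finset A)

theorem countBelow_union_inter (X Y : Finset A) :
    countBelow r X + countBelow r Y ≤ countBelow r (X ∪ Y) + countBelow r (X ∩ Y) := by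
  classical
  unfold countBelow
  rw [← Finset.card_union_add_card_inter]
  refine add_le_add (Finset.card_le_card ?_) (Finset.card_le_card ?_)
  · intro i
    simp only [Finset.mem_union, Finset.mem_filter, Finset.mem_univ, true_and]
    rintro (h | h)
    · exact h.trans Finset.subset_union_left
    · exact h.trans Finset.subset_union_right
  · intro i
    simp only [Finset.mem_inter, Finset.mem_filter, Finset.mem_univ, true_and]
    exact fun h => Finset.subset_inter h.1 h.2

theorem countBelow_union_inter_lt {X Y : Finset A} {i : ι} (hi : r i ⊆ X ∪ Y) (hX : ¬ r i ⊆ X)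
    (hY : ¬ r i ⊆ Y) :
    countBelow r X + countBelow r Y < countBelow r (X ∪ Y) + countBelow r (X ∩ Y) := by
  classical
  unfold countBelow
  rw [← Finset.card_union_add_card_inter]
  refine add_lt_add_of_lt_of_le (Finset.card_lt_card ?_) (Finset.card_le_card ?_)
  · refine (Finset.ssubset_iff_of_subset ?_).2 ⟨i, by simpa using hi, by simp [hX, hY]⟩
    intro j
    simp only [Finset.mem_union, Finset.mem_filter, Finset.mem_univ, true_and]
    rintro (h | h)
    · exact h.trans Finset.subset_union_left
    · exact h.trans Finset.subset_union_right
  · intro j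
    simp only [Finset.mem_inter, Finset.mem_filter, Finset.mem_univ, true_and]
    exact fun h => Finset.subset_inter h.1 h.2

theorem countBelow_update_le [DecidableEq ι] (i : ι) (a : A) (X : Finset A) :
    countBelow (Function.update r i ((r i).erase a)) X ≤ countBelow r X + 1 := by
  unfold countBelow
  refine (Finset.card_le_card (t := insert i (Finset.univ.filter fun j => r j ⊆ X)) ?_).trans
    (Finset.card_insert_le _ _)
  intro j hj
  by_cases h : j = i
  · exact Finset.mem_insert.2 (Or.inl h)
  · simpa [h] using hj

theorem countBelow_update_eq [DecidableEq ι] {i : ι} {a : A} {X : Finset A}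
    (h : r i ⊆ X ↔ (r i).erase a ⊆ X) :
    countBelow (Function.update r i ((r i).erase a)) X = countBelow r X := by
  unfold countBelow
  congr 1
  ext j
  by_cases hj : j = i
  · subst hj
    simp [h]
  · simp [hj]

end countBelow

/-! ### Shrinking the members of a presentation -/

section IsPresentation

variable {P} {ι : Type*} [Fintype ι] {r : ι → Finset A}

/-- If shrinking `r i` by a non-coloop `a` does not preserve being a presentation, then this is
witnessed by a set which spans the same flat as `r i`. -/
theorem IsPresentation.exists_tight [DecidableEq ι] (hr : P.IsPresentation r) {i : ι} {a : A}
    (hspan : r i ⊆ P.cl ((r i).erase a))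
    (hn : ¬ P.IsPresentation (Function.update r i ((r i).erase a))) :
    ∃ X ⊆ P.cl (r i), a ∉ X ∧ (r i).erase a ⊆ X ∧
      X.card ≤ countBelow r X + P.dim (r i) := by
  have hflat : ∀ F, P.IsFlat F →
      countBelow (Function.update r i ((r i).erase a)) F = countBelow r F := fun F hF =>
    countBelow_update_eq r ⟨(Finset.erase_subset _ _).trans,
      fun h => hspan.trans (hF.cl_subset_iff.2 h)⟩
  -- Counts at flats are unchanged, so the failure is a violated inequality. Only member `i`
  -- changed, so `Y` was tight for `r`.
  obtain ⟨Y, hY⟩ : ∃ Y,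
      Y.card < countBelow (Function.update r i ((r i).erase a)) Y + P.dim Y := by
    by_contra! h
    exact hn ⟨h, fun F hF => by rw [hflat F hF, hr.eq F hF]⟩
  have hleY := hr.le Y
  have hiff : ¬ (r i ⊆ Y ↔ (r i).erase a ⊆ Y) := fun h => by
    rw [countBelow_update_eq r h] at hY
    omega
  have hY1 : (r i).erase a ⊆ Y := by
    by_contra h
    exact hiff ⟨(Finset.erase_subset _ _).trans, fun h' => absurd h' h⟩
  have haY : a ∉ Y := by
    intro ha
    refine hiff ⟨(Finset.erase_subset _ _).trans, fun h x hx => ?_⟩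
    by_cases hxa : x = a
    · rwa [hxa]
    · exact h (Finset.mem_erase.2 ⟨hxa, hx⟩)
  have hup := countBelow_update_le r i a Y
  set F := P.cl (r i) with hF
  -- Both `Y` and `F` are tight and `Y ∪ F` has the dimension of `Y`, so supermodularity passes the
  -- bound to `Y ∩ F`.
  refine ⟨Y ∩ F, Finset.inter_subset_right, fun h => haY (Finset.mem_inter.1 h).1,
    Finset.subset_inter hY1 ((Finset.erase_subset _ _).trans (P.subset_cl _)), ?_⟩
  have hFY : F ⊆ P.cl Y := P.cl_subset_iff.2 (hspan.trans (P.cl_mono hY1))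
  have h1 := countBelow_union_inter r Y F
  have h2 := hr.le (Y ∪ F)
  have h3 := P.dim_eq_of_subset_cl (X := Y) (Y := Y ∪ F) Finset.subset_union_left
    (Finset.union_subset (P.subset_cl Y) hFY)
  have h4 := hr.eq F (P.isFlat_cl _)
  have h5 := Finset.card_union_add_card_inter Y F
  have h6 : P.dim F = P.dim (r i) := P.dim_cl _
  omega

/-- A member of a presentation of nullity at least two can be shrunk. -/
theorem IsPresentation.exists_shrink [DecidableEq ι] (hr : P.IsPresentation r) {i : ι}
    (hi : P.dim (r i) + 2 ≤ (r i).card) :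
    ∃ a ∈ r i, P.cl ((r i).erase a) = P.cl (r i) ∧
      P.IsPresentation (Function.update r i ((r i).erase a)) := by
  obtain ⟨B, hB, hcl, -, hBc⟩ := P.exists_basis (r i)
  have hcard := Finset.card_sdiff_add_card_eq_card hB
  obtain ⟨a, ha, b, hb, hab⟩ := Finset.one_lt_card.1 (show 1 < (r i \ B).card by omega)
  rw [Finset.mem_sdiff] at ha hb
  have hspan : ∀ c, c ∉ B → r i ⊆ P.cl ((r i).erase c) := fun c hc =>
    hcl.trans (P.cl_mono (Finset.subset_erase.2 ⟨hB, hc⟩))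
  have hcl_eq : ∀ c, c ∉ B → P.cl ((r i).erase c) = P.cl (r i) := fun c hc =>
    Finset.Subset.antisymm (P.cl_mono (Finset.erase_subset _ _)) (P.cl_subset_iff.2 (hspan c hc))
  by_contra! hcon
  obtain ⟨X, hXF, haX, hX, hXt⟩ :=
    hr.exists_tight (hspan a ha.2) (hcon a ha.1 (hcl_eq a ha.2))
  obtain ⟨Y, hYF, hbY, hY, hYt⟩ :=
    hr.exists_tight (hspan b hb.2) (hcon b hb.1 (hcl_eq b hb.2))
  have hdim : ∀ Z, B ⊆ Z → Z ⊆ P.cl (r i) → P.dim Z = P.dim (r i) := fun Z h1 h2 =>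
    le_antisymm (P.dim_le_dim h2) (P.dim_le_dim (hcl.trans (P.cl_mono h1)))
  have hBX : B ⊆ X := (Finset.subset_erase.2 ⟨hB, ha.2⟩).trans hX
  have hBY : B ⊆ Y := (Finset.subset_erase.2 ⟨hB, hb.2⟩).trans hY
  have hunion : r i ⊆ X ∪ Y := by
    intro x hx
    by_cases hxa : x = a
    · exact Finset.mem_union_right _ (hY (Finset.mem_erase.2 ⟨hxa ▸ hab, hx⟩))
    · exact Finset.mem_union_left _ (hX (Finset.mem_erase.2 ⟨hxa, hx⟩))
  -- `X`, `Y`, `X ∪ Y` and `X ∩ Y` all span `cl (r i)`. Since `r i` lies in the union but in neither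
  -- set, supermodularity is strict, against the tightness of `X` and `Y`.
  have h1 := countBelow_union_inter_lt r hunion (fun h => haX (h ha.1)) (fun h => hbY (h hb.1))
  have h2 := hr.le (X ∪ Y)
  have h3 := hr.le (X ∩ Y)
  rw [hdim _ (hBX.trans Finset.subset_union_left) (Finset.union_subset hXF hYF)] at h2
  rw [hdim _ (Finset.subset_inter hBX hBY) (Finset.inter_subset_left.trans hXF)] at h3
  have h4 := Finset.card_union_add_card_inter X Y
  omega

/-- A presentation can be shrunk to one whose members have nullity one. -/
theorem IsPresentation.exists_minimal (hr : P.IsPresentation r) :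
    ∃ s : ι → Finset A, P.IsPresentation s ∧ (∀ i, P.cl (s i) = P.cl (r i)) ∧
      ∀ i, (s i).card = P.dim (s i) + 1 := by
  classical
  obtain ⟨s, hs, hmin⟩ := Finset.exists_min_image
    (Finset.univ.filter fun s : ι → Finset A =>
      P.IsPresentation s ∧ ∀ i, P.cl (s i) = P.cl (r i))
    (fun s => ∑ i, (s i).card) ⟨r, by simpa using hr⟩
  simp only [Finset.mem_filter, Finset.mem_univ, true_and] at hs hmin
  refine ⟨s, hs.1, hs.2, fun i => le_antisymm ?_ ?_⟩
  · by_contra! h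
    obtain ⟨a, ha, hcl, hs'⟩ := hs.1.exists_shrink (i := i) h
    refine (hmin _ ⟨hs', fun j => ?_⟩).not_gt (Finset.sum_lt_sum (fun j _ => ?_)
      ⟨i, Finset.mem_univ i, ?_⟩)
    · by_cases hj : j = i
      · subst hj
        rw [Function.update_self, hcl, hs.2]
      · rw [Function.update_of_ne hj, hs.2]
    · by_cases hj : j = i
      · subst hj
        rw [Function.update_self]
        exact Finset.card_le_card (Finset.erase_subset _ _)
      · rw [Function.update_of_ne hj]
    · rw [Function.update_self]
      exact Finset.card_erase_lt_of_mem ha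
  -- Each member counts itself, so its nullity is at least one.
  · have h1 := hs.1.le (s i)
    have h2 : 0 < countBelow s (s i) := Finset.card_pos.2 ⟨i, by simp⟩
    omega

/-- Members of nullity one of a presentation are pairwise distinct. -/
theorem IsPresentation.injective (hr : P.IsPresentation r)
    (hc : ∀ i, (r i).card = P.dim (r i) + 1) : Function.Injective r := by
  intro i j hij
  by_contra hne
  have h1 := hr.le (r i)
  have h2 : 1 < countBelow r (r i) :=
    Finset.one_lt_card.2 ⟨i, by simp, j, by simp [hij], hne⟩
  have := hc i
  omega

end IsPresentation

/-- The family of flats in which each flat `F` is repeated `α(F)` times. -/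
def alphaFamily (i : Σ F : {F : Finset A // P.IsFlat F}, Fin (P.alpha F.1).toNat) : Finset A :=
  i.1.1

theorem isPresentation_alphaFamily (h : ∀ X, P.IsUnionOfFlats X → 0 ≤ P.alpha X) :
    P.IsPresentation P.alphaFamily := by
  have hcount : ∀ X, (countBelow P.alphaFamily X : ℤ) =
      ∑ H ∈ Finset.univ.filter P.IsFlat with H ⊆ X, P.alpha H := by
    intro X
    have e : (Finset.univ.filter fun i => P.alphaFamily i ⊆ X) =
        (Finset.univ.filter fun F : {F : Finset A // P.IsFlat F} => F.1 ⊆ X).sigma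
          (fun _ => Finset.univ) := by
      ext i
      simp only [Finset.mem_filter, Finset.mem_sigma, Finset.mem_univ, true_and, and_true]
      rfl
    rw [countBelow, e, Finset.card_sigma, Nat.cast_sum]
    refine Finset.sum_nbij (fun F => F.1) ?_ Subtype.val_injective.injOn ?_ fun F _ => ?_
    · intro F hF
      simpa [F.2] using hF
    · intro H hH
      obtain ⟨hH, hHX⟩ : P.IsFlat H ∧ H ⊆ X := by simpa using hH
      exact ⟨⟨H, hH⟩, by simpa using hHX, rfl⟩
    · rw [Finset.card_univ, Fintype.card_fin]
      exact Int.toNat_of_nonneg (h F.1 ⟨{F.1}, by simpa using F.2, by simp⟩)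
  constructor
  · intro X
    have := P.sum_alpha_le h X
    have := hcount X
    omega
  · intro F hF
    have := hF.sum_alpha_eq
    have := hcount F
    omega

end FinPregeometry

/-! ### Consequences and criteria for being presented by `R` -/

namespace SetSystem

variable {A : Type*} [Fintype A] [DecidableEq A] {R : Finset (Finset A)}

theorem dim_le_delta {X Y : Finset A} (h : X ⊆ Y) : dim R X ≤ delta R Y :=
  Finset.inf'_le _ (Finset.mem_filter.2 ⟨Finset.mem_univ Y, h⟩)

theorem exists_delta_eq_dim (R : Finset (Finset A)) (X : Finset A) :
    ∃ Y, X ⊆ Y ∧ dim R X = delta R Y := by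
  obtain ⟨Y, hY, h⟩ := Finset.exists_mem_eq_inf'
    (s := Finset.univ.filter (fun Y : Finset A => X ⊆ Y))
    ⟨X, Finset.mem_filter.2 ⟨Finset.mem_univ X, Finset.Subset.refl X⟩⟩ (delta R)
  exact ⟨Y, (Finset.mem_filter.1 hY).2, h⟩

theorem dim_mono {X Y : Finset A} (h : X ⊆ Y) : dim R X ≤ dim R Y := by
  obtain ⟨Z, hZ, e⟩ := exists_delta_eq_dim R Y
  rw [e]
  exact dim_le_delta (h.trans hZ)

theorem delta_insert_le (X : Finset A) (y : A) : delta R (insert y X) ≤ delta R X + 1 := by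
  have h1 := Finset.card_insert_le y X
  have h2 : (R.filter (· ⊆ X)).card ≤ (R.filter (· ⊆ insert y X)).card :=
    Finset.card_le_card (Finset.monotone_filter_right _
      fun r _ hr => Finset.Subset.trans hr (Finset.subset_insert y X))
  unfold delta
  omega

theorem dim_insert_le (X : Finset A) (y : A) : dim R (insert y X) ≤ dim R X + 1 := by
  obtain ⟨Z, hZ, e⟩ := exists_delta_eq_dim R X
  rw [e]
  exact (dim_le_delta (Finset.insert_subset_insert y hZ)).trans (delta_insert_le Z y)

theorem MemC.dim_empty (hR : MemC R) : dim R ∅ = 0 := by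
  refine le_antisymm ?_ ?_
  · refine (dim_le_delta subset_rfl).trans (le_of_eq ?_)
    have : R.filter (· ⊆ ∅) = ∅ := by
      refine Finset.filter_eq_empty_iff.2 fun r hr h => ?_
      exact (hR.1 r hr).ne_empty (Finset.subset_empty.1 h)
    rw [delta, this]
    simp
  · obtain ⟨Z, -, e⟩ := exists_delta_eq_dim R ∅
    rw [e]
    exact hR.2 Z

theorem mem_closure {X : Finset A} {y : A} :
    y ∈ closure R X ↔ dim R (insert y X) = dim R X := by
  rw [closure, Finset.mem_filter, Finset.union_comm, ← Finset.insert_eq]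
  simp

variable {P : FinPregeometry A}

/-- Adding a point raises either dimension by 0 or 1, and the common closure operation decides
which. -/
theorem Presents.dim_eq (hR : Presents R P) (X : Finset A) : dim R X = P.dim X := by
  induction X using Finset.induction_on with
  | empty => rw [hR.1.dim_empty, P.dim_empty, Nat.cast_zero]
  | insert y X _ ih =>
    have hy : y ∈ P.cl X ↔ dim R (insert y X) = dim R X := by rw [← hR.2, mem_closure]
    by_cases h : y ∈ P.cl X
    · rw [P.dim_insert_of_mem h, hy.1 h, ih]
    · have h1 := dim_insert_le (R := R) X y
      have h2 := dim_mono (R := R) (Finset.subset_insert y X)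
      have h3 := mt hy.2 h
      rw [P.dim_insert_of_notMem h]
      push_cast
      omega

theorem Presents.dim_le_delta (hR : Presents R P) (X : Finset A) : (P.dim X : ℤ) ≤ delta R X := by
  rw [← hR.dim_eq]
  exact SetSystem.dim_le_delta subset_rfl

/-- Adding to `F` any point of a minimiser `Y ⊇ F` keeps the dimension, so that point lies in `cl F
= F`. -/
theorem Presents.delta_eq (hR : Presents R P) {F : Finset A} (hF : P.IsFlat F) :
    delta R F = P.dim F := by
  obtain ⟨Y, hFY, hY⟩ := exists_delta_eq_dim R F
  suffices Y ⊆ F by rw [← hR.dim_eq, hY, hFY.antisymm this]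
  intro y hy
  have hF' : P.cl F = F := hF
  rw [← hF', ← hR.2, mem_closure]
  refine le_antisymm ?_ (dim_mono (Finset.subset_insert y F))
  rw [hY]
  exact SetSystem.dim_le_delta (Finset.insert_subset hy hFY)

/-- `d` bounds `δ` from below everywhere and is attained at closures, so it equals the minimum
defining `dim R`. -/
theorem presents_of_delta (hne : ∀ r ∈ R, r.Nonempty) (hle : ∀ X, (P.dim X : ℤ) ≤ delta R X)
    (heq : ∀ F, P.IsFlat F → delta R F = P.dim F) : Presents R P := by
  refine ⟨⟨hne, fun X => (Nat.cast_nonneg _).trans (hle X)⟩, fun X => ?_⟩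
  have hdim : ∀ X, dim R X = P.dim X := by
    intro X
    refine le_antisymm ?_ ?_
    · rw [← P.dim_cl X, ← heq _ (P.isFlat_cl X)]
      exact SetSystem.dim_le_delta (P.subset_cl X)
    · obtain ⟨Y, hXY, hY⟩ := exists_delta_eq_dim R X
      rw [hY]
      exact (Nat.cast_le.2 (P.dim_mono hXY)).trans (hle Y)
  ext y
  rw [mem_closure, hdim, hdim, Nat.cast_inj, P.dim_insert_eq_iff]

theorem Presents.Delta_eq (hR : Presents R P) {𝓕 : Finset (Finset A)}
    (h𝓕 : ∀ F ∈ 𝓕, P.IsFlat F) :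
    P.Delta 𝓕 = P.dim (𝓕.biUnion id) - (𝓕.biUnion id).card
      + (R.filter fun r => ∃ F ∈ 𝓕, r ⊆ F).card := by
  rw [P.Delta_eq_of_weights R (fun _ => 1) _ 𝓕 h𝓕]
  · simp
  · intro F hF
    rw [← hR.delta_eq hF, delta]
    simp

theorem Presents.isFlatPregeometry (hR : Presents R P) : P.IsFlatPregeometry := by
  intro 𝓕 _ h𝓕
  rw [hR.Delta_eq h𝓕]
  have h1 := hR.dim_le_delta (𝓕.biUnion id)
  have h2 : (R.filter fun r => ∃ F ∈ 𝓕, r ⊆ F).card ≤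
      (R.filter (· ⊆ 𝓕.biUnion id)).card := by
    refine Finset.card_le_card (Finset.monotone_filter_right _ ?_)
    rintro r _ ⟨F, hF, hrF⟩
    exact Finset.Subset.trans hrF (Finset.subset_biUnion_of_mem id hF)
  unfold delta at h1
  omega

theorem Presents.dim_lt_card (hR : Presents R P) {r : Finset A} (hr : r ∈ R) :
    P.dim r < r.card := by
  have h1 := hR.dim_le_delta r
  have h2 : 0 < (R.filter (· ⊆ r)).card := Finset.card_pos.2 ⟨r, by simp [hr]⟩
  unfold delta at h1
  omega

/-- A member has dimension below its size, hence below `k`. It cannot span `X`, so every member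
inside `X` lies in a proper subflat. -/
theorem Presents.Delta_properFlats_eq_zero (hR : Presents R P) {k : ℕ} (hk : ∀ r ∈ R, r.card ≤ k)
    {X : Finset A} (hX : P.IsFlat X) (hkX : k ≤ P.dim X) : P.Delta (P.properFlats X) = 0 := by
  by_cases hU : (P.properFlats X).biUnion id = X
  · rw [hR.Delta_eq fun F hF => (P.mem_properFlats.1 hF).2, hU]
    have h1 := hR.delta_eq hX
    have h2 : R.filter (fun r => ∃ F ∈ P.properFlats X, r ⊆ F) = R.filter (· ⊆ X) := by
      refine Finset.filter_congr fun r hr => ⟨?_, fun hrX => ?_⟩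
      · rintro ⟨F, hF, hrF⟩
        exact hrF.trans (P.mem_properFlats.1 hF).1.subset
      · refine ⟨P.cl r, P.mem_properFlats.2 ⟨?_, P.isFlat_cl r⟩, P.subset_cl r⟩
        refine (hX.cl_subset_iff.2 hrX).ssubset_of_ne fun e => ?_
        have h3 := P.dim_cl r
        have h4 := hR.dim_lt_card hr
        have h5 := hk r hr
        rw [e] at h3
        omega
    rw [h2, ← h1, delta]
    ring
  · exact (P.of_biUnion_properFlats_ne hX hU).1

end SetSystem

/-! ### Constructing `R`, and the main theorem -/

/-- If `α` is nonnegative on unions of flats, then `P` is presented by a set of circuits, each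
spanning a flat on which `α` is positive. -/
theorem FinPregeometry.exists_presents_of_alpha_nonneg {A : Type*} [Fintype A] [DecidableEq A]
    (P : FinPregeometry A) (h : ∀ X, P.IsUnionOfFlats X → 0 ≤ P.alpha X) :
    ∃ R : Finset (Finset A), SetSystem.Presents R P ∧
      ∀ r ∈ R, r.card = P.dim r + 1 ∧ 0 < P.alpha (P.cl r) := by
  obtain ⟨s, hs, hcl, hcard⟩ := (P.isPresentation_alphaFamily h).exists_minimal
  have hinj := hs.injective hcard
  have hdelta : ∀ X, SetSystem.delta (Finset.univ.image s) X =
      (X.card : ℤ) - (countBelow s X : ℤ) := by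
    intro X
    rw [SetSystem.delta, Finset.filter_image, Finset.card_image_of_injective _ hinj, countBelow]
  refine ⟨Finset.univ.image s, SetSystem.presents_of_delta ?_ ?_ ?_, ?_⟩
  · intro r hr
    obtain ⟨i, -, rfl⟩ := Finset.mem_image.1 hr
    exact Finset.card_pos.1 (by rw [hcard]; omega)
  · intro X
    have := hs.le X
    rw [hdelta]
    omega
  · intro F hF
    have := hs.eq F hF
    rw [hdelta]
    omega
  · intro r hr
    obtain ⟨i, -, rfl⟩ := Finset.mem_image.1 hr
    refine ⟨hcard i, ?_⟩
    have hF : P.cl (P.alphaFamily i) = i.1.1 := i.1.2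
    rw [hcl, hF]
    have := i.2.2
    omega

theorem mainTheorem1 {A : Type*} [Fintype A] [DecidableEq A] (P : FinPregeometry A) :
    List.TFAE
      [∃ R : Finset (Finset A), SetSystem.Presents R P,
       ∀ X : Finset A, P.IsUnionOfFlats X → 0 ≤ P.alpha X,
       ∀ X : Finset A, P.IsUnionOfFlats X → P.Delta (P.properFlats X) ≤ 0,
       P.IsFlatPregeometry] ∧
    ((∃ R : Finset (Finset A), SetSystem.Presents R P) →
      (∀ k : ℕ, 2 ≤ k →
        ((∃ R : Finset (Finset A), SetSystem.Presents R P ∧ ∀ r ∈ R, r.card ≤ k) ↔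
          ∀ X : Finset A, P.IsFlat X → k ≤ P.dim X → P.Delta (P.properFlats X) = 0)) ∧
      (∀ k : ℕ,
        (∃ R : Finset (Finset A), SetSystem.Presents R P ∧ ∀ r ∈ R, r.card ≤ k) →
          ∀ X : Finset A, P.IsFlat X → k ≤ P.dim X → P.Delta (P.properFlats X) = 0)) := by
  have tfae : List.TFAE
      [∃ R : Finset (Finset A), SetSystem.Presents R P,
       ∀ X : Finset A, P.IsUnionOfFlats X → 0 ≤ P.alpha X,
       ∀ X : Finset A, P.IsUnionOfFlats X → P.Delta (P.properFlats X) ≤ 0,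
       P.IsFlatPregeometry] := by
    tfae_have 1 → 4 := fun ⟨R, hR⟩ => hR.isFlatPregeometry
    tfae_have 4 → 3 := by
      intro h X _
      rcases (P.properFlats X).eq_empty_or_nonempty with h0 | h0
      · rw [h0, P.Delta_empty]
      · exact h _ h0 fun F hF => (P.mem_properFlats.1 hF).2
    tfae_have 3 → 2 := by
      intro h X hX
      by_cases hU : (P.properFlats X).biUnion id = X
      · rw [P.alpha_eq_neg_Delta hU]
        exact neg_nonneg.2 (h X hX)
      · exact (P.of_biUnion_properFlats_ne (hX.isFlat hU) hU).2.1
    tfae_have 2 → 1 := fun h => (P.exists_presents_of_alpha_nonneg h).imp fun _ hR => hR.1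
    tfae_finish
  have honly : ∀ k : ℕ,
      (∃ R : Finset (Finset A), SetSystem.Presents R P ∧ ∀ r ∈ R, r.card ≤ k) →
        ∀ X : Finset A, P.IsFlat X → k ≤ P.dim X → P.Delta (P.properFlats X) = 0 :=
    fun k ⟨R, hR, hk⟩ X hX hkX => hR.Delta_properFlats_eq_zero hk hX hkX
  refine ⟨tfae, fun hpres => ⟨fun k hk => ⟨honly k, fun hzero => ?_⟩, honly⟩⟩
  obtain ⟨R, hR, hc⟩ := P.exists_presents_of_alpha_nonneg ((tfae.out 0 1).1 hpres)
  refine ⟨R, hR, fun r hr => ?_⟩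
  obtain ⟨hcard, hα⟩ := hc r hr
  by_contra! hlt
  have hdim : k ≤ P.dim (P.cl r) := by
    rw [P.dim_cl]
    omega
  by_cases hU : (P.properFlats (P.cl r)).biUnion id = P.cl r
  · rw [P.alpha_eq_neg_Delta hU, hzero _ (P.isFlat_cl r) hdim] at hα
    omega
  -- Here the dimension is at most one, which `2 ≤ k` excludes.
  · have := (P.of_biUnion_properFlats_ne (P.isFlat_cl r) hU).2.2
    omega
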